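/- Let $N\in\mathbb N$, let $k>N/2+2$ be a real number, and let $u_0\in H^k(\mathbb R^N;\mathbb R^N)$ (identified with its continuous representative, which is of class $C^2$) be odd, $u_0(-x)=-u_0(x)$ for all $x$, with $\operatorname{div}u_0(0)<0$. Consider the zero dispersion ($\alpha=0$) Euler–Poincaré equations $$\partial_t u+\operatorname{div}(u\otimes u)+\tfrac12\nabla|u|^2=0,\qquad u(\cdot,0)=u_0,$$ that is, $\partial_t u_i+\sum_{j}\partial_j(u_iu_j)+\tfrac12\partial_i|u|^2=0$ for $i=1,\dots,N$. A classical solution on $[0,T)$, $0<T<\infty$, is a function $u\in C([0,T);H^k(\mathbb R^N;\mathbb R^N))$ that is $C^1$ on $[0,T)\times\mathbb R^N$, satisfies the equations pointwise for $0<t<T$, and has $u(\cdot,0)=u_0$. Let $T_*\in[0,\infty]$ be the maximal time of existence of the classical solution, i.e. the supremum of all $T$ for which there is a classical solution on $[0,T)$. Then the classical solution blows up in finite time, in the sense that $T_*<\infty$; more precisely, $$T_*\le\frac{1}{|\operatorname{div}u_0(0)|}.$$ -/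

import Mathlib

open MeasureTheory Set
open scoped ENNReal

noncomputable section

namespace ZeroDispersion

/-- The Euclidean space `ℝ^N`. -/
abbrev Space (N : ℕ) : Type := EuclideanSpace ℝ (Fin N)

/-- The classical partial derivative `∂_j f (x)`. -/
def partialDeriv {N : ℕ} (j : Fin N) (f : Space N → ℝ) (x : Space N) : ℝ :=
  fderiv ℝ f x (EuclideanSpace.single j 1)

/-- The divergence `div v (x) = ∑ᵢ ∂ᵢ vᵢ (x)`. -/
def divergence {N : ℕ} (v : Space N → Space N) (x : Space N) : ℝ :=
  ∑ i, partialDeriv i (fun y => v y i) x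

/-- The real function `f` is square integrable, and the Bessel potential of order `s` of `f`
(as a tempered distribution) is the `L²` function `g`. Thus `f ∈ H^s`, and the `L²` norm of `g`
is the `H^s` norm of `f`. -/
def HasBesselPotential {N : ℕ} (s : ℝ) (f : Space N → ℝ)
    (g : Lp ℂ 2 (volume : Measure (Space N))) : Prop :=
  ∃ hf : MemLp (fun x => (f x : ℂ)) 2 (volume : Measure (Space N)),
    TemperedDistribution.besselPotential (Space N) ℂ s (hf.toLp (fun x => (f x : ℂ))) = g

/-- The vector field `v` belongs to the Sobolev space `H^s(ℝ^N)`. -/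
def MemHs {N : ℕ} (s : ℝ) (v : Space N → Space N) : Prop :=
  ∀ i, ∃ hf : MemLp (fun x => (v x i : ℂ)) 2 (volume : Measure (Space N)),
    TemperedDistribution.MemSobolev s 2
      (hf.toLp (fun x => (v x i : ℂ)) : TemperedDistribution (Space N) ℂ)

/-- The curve `t ↦ u t` belongs to `C([0, T); H^s(ℝ^N))`: the map `f ↦ (Bessel potential of f)`
is an isometry of `H^s` onto `L²`, so continuity in `H^s` is continuity of the Bessel potentials
in `L²`. -/
def ContinuousInHs {N : ℕ} (s T : ℝ) (u : ℝ → Space N → Space N) : Prop :=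
  ∀ i, ∃ w : ℝ → Lp ℂ 2 (volume : Measure (Space N)),
    ContinuousOn w (Ico 0 T) ∧
      ∀ t ∈ Ico 0 T, HasBesselPotential s (fun x => u t x i) (w t)

/-- `u` is a classical solution on the time interval `[0, T)`, in the class `C([0, T); H^s)`, of
`∂_t u + div (u ⊗ u) + ½ ∇|u|² = 0`, `u(·, 0) = u₀`. -/
structure IsClassicalSolution {N : ℕ} (s : ℝ) (u₀ : Space N → Space N) (T : ℝ)
    (u : ℝ → Space N → Space N) : Prop where
  pos : 0 < T
  continuousInHs : ContinuousInHs s T u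
  contDiffOn : ContDiffOn ℝ 1 (fun p : ℝ × Space N => u p.1 p.2) (Ico 0 T ×ˢ univ)
  initial : u 0 = u₀
  equation : ∀ t ∈ Ioo 0 T, ∀ (x : Space N) (i : Fin N),
    deriv (fun τ => u τ x i) t
      + ∑ j, partialDeriv j (fun y => u t y i * u t y j) x
      + (1 / 2) * partialDeriv i (fun y => ‖u t y‖ ^ 2) x = 0

/-- The maximal time of existence `T_* ∈ [0, ∞]` of the classical solution in `H^s` with initial
data `u₀`: the supremum of all `T` such that a classical solution exists on `[0, T)`. -/
def maximalTime {N : ℕ} (s : ℝ) (u₀ : Space N → Space N) : ℝ≥0∞ :=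
  ⨆ (T : ℝ) (_ : ∃ u, IsClassicalSolution s u₀ T u), ENNReal.ofReal T

end ZeroDispersion

end

/-!
The equations read `∂ₜu = Φ(Du) u` with `Φ(A) = -(A + Aᵀ + tr A)`. At a fixed point `x₀` this is a
linear ordinary differential equation for `t ↦ u(t, x₀)`, so a zero of `u₀` (such as the origin, for
odd data) stays a zero of `u(t)`. At such a point the second derivatives of `u` do not contribute to
the evolution of the Jacobian `A = Du(t, x₀)`, which therefore solves `A' = Φ(A) A`. Since
`tr ((A + Aᵀ) A) = ½ |A + Aᵀ|² ≥ 0`, its trace `d = div u(t, x₀)` satisfies the Riccati inequality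
`d' ≤ -d²`, and cannot exist beyond time `1 / |d(0)|` when `d(0) < 0`.
-/

open Filter Topology InnerProductSpace

namespace ZeroDispersion

section Calculus

lemma exists_bound_of_continuousOn_slab {E F : Type*} [PseudoMetricSpace E] [ProperSpace E]
    [SeminormedAddGroup F] {f : ℝ → E → F} {a b : ℝ} (x₀ : E)
    (hf : ContinuousOn (Function.uncurry f) (Icc a b ×ˢ univ)) :
    ∃ K, ∀ t ∈ Icc a b, ∀ x ∈ Metric.closedBall x₀ 1, ‖f t x‖ ≤ K := by
  obtain ⟨K, hK⟩ := (isCompact_Icc.prod (isCompact_closedBall x₀ 1)).exists_bound_of_continuousOn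
    (hf.mono (prod_mono_right (subset_univ _)))
  exact ⟨K, fun t ht x hx => hK (t, x) ⟨ht, hx⟩⟩

variable {E F G : Type*} [NormedAddCommGroup E] [NormedSpace ℝ E] [NormedAddCommGroup F]
  [NormedSpace ℝ F] [NormedAddCommGroup G] [NormedSpace ℝ G]

lemma hasFDerivAt_clm_apply_of_eq_zero {c : E → F →L[ℝ] G} {v : E → F} {v' : E →L[ℝ] F} {x₀ : E}
    (hc : ContinuousAt c x₀) (hv : HasFDerivAt v v' x₀) (h₀ : v x₀ = 0) :
    HasFDerivAt (fun x => c x (v x)) (c x₀ ∘L v') x₀ := by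
  have hmain : HasFDerivAt (fun x => c x₀ (v x)) (c x₀ ∘L v') x₀ :=
    (c x₀).hasFDerivAt.comp x₀ hv
  have hv_bound : v =O[𝓝 x₀] fun x => x - x₀ := by
    simpa [h₀] using hv.isBigO_sub
  have hc_small : (fun x => c x - c x₀) =o[𝓝 x₀] fun _ => (1 : ℝ) :=
    (Asymptotics.isLittleO_one_iff ℝ).2 (tendsto_sub_nhds_zero_iff.2 hc)
  have hrest : (fun x => (c x - c x₀) (v x)) =o[𝓝 x₀] fun x => x - x₀ := by
    have hprod := hc_small.norm_left.mul_isBigO hv_bound.norm_norm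
    simp only [one_mul] at hprod
    refine (Asymptotics.IsBigO.of_bound 1 (Eventually.of_forall fun x => ?_)).trans_isLittleO
      hprod.of_norm_right
    simpa using (c x - c x₀).le_opNorm (v x)
  refine .of_isLittleO ((hmain.isLittleO.add hrest).congr_left fun x => ?_)
  simp [h₀]

lemma hasFDerivAt_integral_clm_apply_of_eq_zero [ProperSpace E]
    {c : ℝ → E → F →L[ℝ] G} {v : ℝ → E → F} {v' : ℝ → E → E →L[ℝ] F} {a b : ℝ} {x₀ : E}
    (hab : a ≤ b)
    (hc : ContinuousOn (Function.uncurry c) (Icc a b ×ˢ univ))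
    (hv : ContinuousOn (Function.uncurry v) (Icc a b ×ˢ univ))
    (hv' : ContinuousOn (Function.uncurry v') (Icc a b ×ˢ univ))
    (hderiv : ∀ t ∈ Icc a b, ∀ x, HasFDerivAt (v t) (v' t x) x)
    (h₀ : ∀ t ∈ Icc a b, v t x₀ = 0) :
    HasFDerivAt (fun x => ∫ t in a..b, c t x (v t x)) (∫ t in a..b, c t x₀ ∘L v' t x₀) x₀ := by
  obtain ⟨K, hK⟩ := exists_bound_of_continuousOn_slab x₀ hc
  obtain ⟨L, hL⟩ := exists_bound_of_continuousOn_slab x₀ hv'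
  have hball : Metric.closedBall x₀ 1 ∈ 𝓝 x₀ := Metric.closedBall_mem_nhds x₀ one_pos
  have hIoc : ∀ᵐ t ∂volume.restrict (Ioc a b), t ∈ Icc a b :=
    (ae_restrict_mem measurableSet_Ioc).mono fun _ ht => Ioc_subset_Icc_self ht
  have hv_bound : ∀ t ∈ Icc a b, ∀ x ∈ Metric.closedBall x₀ 1, ‖v t x‖ ≤ L * ‖x - x₀‖ := by
    intro t ht x hx
    simpa [h₀ t ht] using (convex_closedBall x₀ 1).norm_image_sub_le_of_norm_hasFDerivWithin_le
      (fun y _ => (hderiv t ht y).hasFDerivWithinAt) (hL t ht) (mem_of_mem_nhds hball) hx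
  have hmeas : ∀ x, AEStronglyMeasurable (fun t => c t x (v t x)) (volume.restrict (Ioc a b)) :=
    fun x => (((hc.uncurry_right x (mem_univ x)).clm_apply (hv.uncurry_right x (mem_univ x))).mono
      Ioc_subset_Icc_self).aestronglyMeasurable measurableSet_Ioc
  simp only [intervalIntegral.integral_of_le hab]
  refine (hasFDerivAt_integral_of_dominated_loc_of_lip' (bound := fun _ => K * L) hball
    (fun x _ => hmeas x) ?_ ?_ ?_ (integrable_const _) ?_).2
  · exact (integrable_zero _ _ _).congr (hIoc.mono fun t ht => by simp [h₀ t ht])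
  · exact (((hc.uncurry_right x₀ (mem_univ x₀)).clm_comp (hv'.uncurry_right x₀ (mem_univ x₀))).mono
      Ioc_subset_Icc_self).aestronglyMeasurable measurableSet_Ioc
  · filter_upwards [hIoc] with t ht x hx
    calc ‖c t x (v t x) - c t x₀ (v t x₀)‖ = ‖c t x (v t x)‖ := by simp [h₀ t ht]
      _ ≤ K * (L * ‖x - x₀‖) := (c t x).le_of_opNorm_le_of_le (hK t ht x hx) (hv_bound t ht x hx)
      _ = K * L * ‖x - x₀‖ := (mul_assoc _ _ _).symm
  · filter_upwards [hIoc] with t ht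
    exact hasFDerivAt_clm_apply_of_eq_zero ((hc.uncurry_left t ht).continuousAt univ_mem)
      (hderiv t ht x₀) (h₀ t ht)

lemma lt_one_div_abs_of_deriv_le_neg_sq {d d' : ℝ → ℝ} {a b : ℝ} (hab : a ≤ b)
    (hcont : ContinuousOn d (Icc a b)) (hderiv : ∀ t ∈ Ioo a b, HasDerivAt d (d' t) t)
    (hle : ∀ t ∈ Ioo a b, d' t ≤ -d t ^ 2) (ha : d a < 0) : b - a < 1 / |d a| := by
  rw [← interior_Icc] at hderiv hle
  have hanti : AntitoneOn d (Icc a b) :=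
    antitoneOn_of_hasDerivWithinAt_nonpos (convex_Icc a b) hcont
      (fun t ht => (hderiv t ht).hasDerivWithinAt)
      fun t ht => (hle t ht).trans (neg_nonpos.2 (sq_nonneg _))
  have hneg : ∀ t ∈ Icc a b, d t < 0 := fun t ht =>
    (hanti (left_mem_Icc.2 hab) ht ht.1).trans_lt ha
  have hmono : MonotoneOn (fun t => (d t)⁻¹ - t) (Icc a b) := by
    refine monotoneOn_of_hasDerivWithinAt_nonneg (convex_Icc a b)
      ((hcont.inv₀ fun t ht => (hneg t ht).ne).sub continuousOn_id)
      (fun t ht => (((hderiv t ht).inv (hneg t (interior_subset ht)).ne).sub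
        (hasDerivAt_id t)).hasDerivWithinAt) fun t ht => ?_
    rw [sub_nonneg, le_div_iff₀ (sq_pos_of_neg (hneg t (interior_subset ht)))]
    linarith [hle t ht]
  have hends : (d a)⁻¹ - a ≤ (d b)⁻¹ - b :=
    hmono (left_mem_Icc.2 hab) (right_mem_Icc.2 hab) hab
  have hb : (d b)⁻¹ < 0 := inv_lt_zero.2 (hneg b (right_mem_Icc.2 hab))
  rw [abs_of_neg ha, one_div, inv_neg]
  linarith

end Calculus

section QuasilinearSystem

variable {E F : Type*} [NormedAddCommGroup E] [NormedSpace ℝ E] [NormedAddCommGroup F]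
  [NormedSpace ℝ F]

/-- `u` is a `C¹` solution on `[0, T)` of the first-order system `∂ₜu = Φ(Du) u`, where `Du` is the
spatial derivative. The equation is required for `0 < t` only, as in `IsClassicalSolution`. -/
structure IsQuasilinearSolution (Φ : (E →L[ℝ] F) → F →L[ℝ] F) (T : ℝ) (u : ℝ → E → F) :
    Prop where
  contDiffOn : ContDiffOn ℝ 1 (Function.uncurry u) (Ico 0 T ×ˢ univ)
  hasDerivAt : ∀ t ∈ Ioo 0 T, ∀ x,
    HasDerivAt (fun τ => u τ x) (Φ (fderiv ℝ (u t) x) (u t x)) t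

namespace IsQuasilinearSolution

variable {Φ : (E →L[ℝ] F) → F →L[ℝ] F} {T : ℝ} {u : ℝ → E → F} {x₀ : E}

lemma hasFDerivAt (hu : IsQuasilinearSolution Φ T u) {t : ℝ} (ht : t ∈ Ico 0 T) (x : E) :
    HasFDerivAt (u t) (fderiv ℝ (u t) x) x := by
  have hslice : ContDiffOn ℝ 1 (u t) univ :=
    hu.contDiffOn.comp (f := fun x : E => (t, x)) (by fun_prop) fun _ _ => ⟨ht, trivial⟩
  exact ((contDiffOn_univ.1 hslice).differentiable one_ne_zero x).hasFDerivAt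

lemma continuousOn_fderiv (hu : IsQuasilinearSolution Φ T u) :
    ContinuousOn (Function.uncurry fun t x => fderiv ℝ (u t) x) (Ico 0 T ×ˢ univ) := by
  have hunique : UniqueDiffOn ℝ (Ico 0 T ×ˢ (univ : Set E)) :=
    (uniqueDiffOn_Ico 0 T).prod uniqueDiffOn_univ
  refine ((hu.contDiffOn.continuousOn_fderivWithin hunique le_rfl).clm_comp
    (continuousOn_const (c := ContinuousLinearMap.inr ℝ ℝ E))).congr fun p hp => ?_
  have hjoint := (hu.contDiffOn.differentiableOn one_ne_zero p hp).hasFDerivWithinAt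
  have hslice := hjoint.comp p.2 (f := fun x : E => (p.1, x))
    (hasFDerivAt_prodMk_right p.1 p.2).hasFDerivWithinAt
    fun x (_ : x ∈ univ) => ⟨hp.1, trivial⟩
  exact (hasFDerivWithinAt_univ.1 hslice).fderiv

lemma continuousOn_coeff (hu : IsQuasilinearSolution Φ T u) (hΦ : Continuous Φ) :
    ContinuousOn (Function.uncurry fun t x => Φ (fderiv ℝ (u t) x)) (Ico 0 T ×ˢ univ) :=
  hΦ.comp_continuousOn hu.continuousOn_fderiv

lemma continuousOn_rhs (hu : IsQuasilinearSolution Φ T u) (hΦ : Continuous Φ) (x : E) :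
    ContinuousOn (fun t => Φ (fderiv ℝ (u t) x) (u t x)) (Ico 0 T) :=
  ((hu.continuousOn_coeff hΦ).uncurry_right x (mem_univ x)).clm_apply
    (hu.contDiffOn.continuousOn.uncurry_right x (mem_univ x))

lemma hasDerivWithinAt_Ici (hu : IsQuasilinearSolution Φ T u) (hΦ : Continuous Φ) {t : ℝ}
    (ht : t ∈ Ico 0 T) (x : E) :
    HasDerivWithinAt (fun τ => u τ x) (Φ (fderiv ℝ (u t) x) (u t x)) (Ici t) t := by
  have hIoo : Ioo t T ⊆ Ioo 0 T := Ioo_subset_Ioo_left ht.1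
  have hnhds : Ioo t T ∈ 𝓝[>] t := Ioo_mem_nhdsGT ht.2
  have hIco : Ioo t T ⊆ Ico 0 T := hIoo.trans Ioo_subset_Ico_self
  refine hasDerivWithinAt_Ici_of_tendsto_deriv
    (fun τ hτ => (hu.hasDerivAt τ (hIoo hτ) x).differentiableAt.differentiableWithinAt)
    ((hu.contDiffOn.continuousOn.uncurry_right x (mem_univ x) t ht).mono hIco) hnhds ?_
  refine ((hu.continuousOn_rhs hΦ x t ht).mono_left
    (nhdsWithin_le_iff.2 (mem_of_superset hnhds hIco))).congr' ?_
  filter_upwards [hnhds] with τ hτ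
  exact (hu.hasDerivAt τ (hIoo hτ) x).deriv.symm

/- At a fixed point `x` the equation is a linear ordinary differential equation for `t ↦ u t x`,
with continuous coefficient `Φ(Du(t, x))`. -/
lemma apply_eq_zero (hu : IsQuasilinearSolution Φ T u) (hΦ : Continuous Φ) (h₀ : u 0 x₀ = 0)
    {t : ℝ} (ht : t ∈ Ico 0 T) : u t x₀ = 0 := by
  have hsub : Icc 0 t ⊆ Ico 0 T := Icc_subset_Ico_right ht.2
  obtain ⟨K, hK⟩ := isCompact_Icc.exists_bound_of_continuousOn
    (((hu.continuousOn_coeff hΦ).uncurry_right x₀ (mem_univ x₀)).mono hsub)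
  exact eq_zero_of_abs_deriv_le_mul_abs_self_of_eq_zero_right
    ((hu.contDiffOn.continuousOn.uncurry_right x₀ (mem_univ x₀)).mono hsub)
    (fun τ hτ => hu.hasDerivWithinAt_Ici hΦ (hsub (Ico_subset_Icc_self hτ)) x₀) h₀
    (fun τ hτ => (Φ _).le_of_opNorm_le (hK τ (Ico_subset_Icc_self hτ)) _) t ⟨ht.1, le_rfl⟩

lemma continuousOn_coeff_comp_fderiv (hu : IsQuasilinearSolution Φ T u) (hΦ : Continuous Φ)
    (x : E) :
    ContinuousOn (fun t => Φ (fderiv ℝ (u t) x) ∘L fderiv ℝ (u t) x) (Ico 0 T) :=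
  ((hu.continuousOn_coeff hΦ).uncurry_right x (mem_univ x)).clm_comp
    (hu.continuousOn_fderiv.uncurry_right x (mem_univ x))

variable [CompleteSpace F]

lemma integral_eq_sub (hu : IsQuasilinearSolution Φ T u) (hΦ : Continuous Φ) {t : ℝ}
    (ht : t ∈ Ico 0 T) (x : E) :
    ∫ τ in (0)..t, Φ (fderiv ℝ (u τ) x) (u τ x) = u t x - u 0 x := by
  have hsub : Icc 0 t ⊆ Ico 0 T := Icc_subset_Ico_right ht.2
  exact intervalIntegral.integral_eq_sub_of_hasDerivAt_of_le ht.1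
    ((hu.contDiffOn.continuousOn.uncurry_right x (mem_univ x)).mono hsub)
    (fun τ hτ => hu.hasDerivAt τ (Ioo_subset_Ioo_right ht.2.le hτ) x)
    (((hu.continuousOn_rhs hΦ x).mono hsub).intervalIntegrable_of_Icc ht.1)

variable [ProperSpace E]

/- The second derivatives of `u`, which need not exist, would enter the equation for `Du` only
multiplied by `u`, hence drop out where `u` vanishes. -/
lemma integral_coeff_comp_fderiv_eq_sub (hu : IsQuasilinearSolution Φ T u) (hΦ : Continuous Φ)
    (h₀ : u 0 x₀ = 0) {t : ℝ} (ht : t ∈ Ico 0 T) :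
    ∫ τ in (0)..t, Φ (fderiv ℝ (u τ) x₀) ∘L fderiv ℝ (u τ) x₀ =
      fderiv ℝ (u t) x₀ - fderiv ℝ (u 0) x₀ := by
  have hsub : Icc 0 t ⊆ Ico 0 T := Icc_subset_Ico_right ht.2
  have hsub' : Icc 0 t ×ˢ (univ : Set E) ⊆ Ico 0 T ×ˢ univ := prod_mono_left hsub
  have hintegral := hasFDerivAt_integral_clm_apply_of_eq_zero ht.1
    ((hu.continuousOn_coeff hΦ).mono hsub') (hu.contDiffOn.continuousOn.mono hsub')
    (hu.continuousOn_fderiv.mono hsub') (fun τ hτ x => hu.hasFDerivAt (hsub hτ) x)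
    (fun τ hτ => hu.apply_eq_zero hΦ h₀ (hsub hτ))
  have hincrement := (hu.hasFDerivAt ht x₀).sub (hu.hasFDerivAt ⟨le_rfl, ht.1.trans_lt ht.2⟩ x₀)
  simp only [hu.integral_eq_sub hΦ ht] at hintegral
  exact hintegral.unique hincrement

lemma hasDerivAt_fderiv (hu : IsQuasilinearSolution Φ T u) (hΦ : Continuous Φ)
    (h₀ : u 0 x₀ = 0) {t : ℝ} (ht : t ∈ Ioo 0 T) :
    HasDerivAt (fun τ => fderiv ℝ (u τ) x₀) (Φ (fderiv ℝ (u t) x₀) ∘L fderiv ℝ (u t) x₀) t := by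
  have hcont := hu.continuousOn_coeff_comp_fderiv hΦ x₀
  have hintegral := intervalIntegral.integral_hasDerivAt_right
    ((hcont.mono (Icc_subset_Ico_right ht.2)).intervalIntegrable_of_Icc ht.1.le)
    ((hcont.mono Ioo_subset_Ico_self).stronglyMeasurableAtFilter isOpen_Ioo t ht)
    (hcont.continuousAt (Ico_mem_nhds ht.1 ht.2))
  refine (hintegral.const_add (fderiv ℝ (u 0) x₀)).congr_of_eventuallyEq ?_
  filter_upwards [isOpen_Ioo.mem_nhds ht] with τ hτ
  rw [hu.integral_coeff_comp_fderiv_eq_sub hΦ h₀ (Ioo_subset_Ico_self hτ), add_sub_cancel]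

end IsQuasilinearSolution

end QuasilinearSystem

section EulerPoincare

variable {E : Type*} [NormedAddCommGroup E] [InnerProductSpace ℝ E] [FiniteDimensional ℝ E]

/-- The trace as a continuous linear functional; for `A = Dv(x)` it is the divergence of `v`
at `x`. -/
noncomputable def traceCLM : (E →L[ℝ] E) →L[ℝ] ℝ :=
  (LinearMap.trace ℝ E ∘ₗ ContinuousLinearMap.coeLM ℝ).toContinuousLinearMap

lemma traceCLM_eq_sum_inner {ι : Type*} [Fintype ι] (b : OrthonormalBasis ι ℝ E)
    (A : E →L[ℝ] E) : traceCLM A = ∑ i, ⟪b i, A (b i)⟫_ℝ :=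
  LinearMap.trace_eq_sum_inner (A : E →ₗ[ℝ] E) b

lemma traceCLM_adjoint (A : E →L[ℝ] E) : traceCLM A.adjoint = traceCLM A := by
  simp only [traceCLM_eq_sum_inner (stdOrthonormalBasis ℝ E),
    ContinuousLinearMap.adjoint_inner_right, real_inner_comm]

lemma traceCLM_adjoint_comp_self_nonneg (A : E →L[ℝ] E) : 0 ≤ traceCLM (A.adjoint ∘L A) := by
  rw [traceCLM_eq_sum_inner (stdOrthonormalBasis ℝ E)]
  refine Finset.sum_nonneg fun i _ => ?_
  rw [ContinuousLinearMap.comp_apply, ContinuousLinearMap.adjoint_inner_right]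
  exact real_inner_self_nonneg

lemma traceCLM_comp_comm (A B : E →L[ℝ] E) : traceCLM (A ∘L B) = traceCLM (B ∘L A) :=
  LinearMap.trace_mul_comm ℝ (A : E →ₗ[ℝ] E) (B : E →ₗ[ℝ] E)

lemma traceCLM_self_add_adjoint_comp_self_nonneg (A : E →L[ℝ] E) :
    0 ≤ traceCLM ((A + A.adjoint) ∘L A) := by
  set S := A + A.adjoint with hS
  have hself : S.adjoint = S := by
    rw [hS, map_add, ContinuousLinearMap.adjoint_adjoint, add_comm]
  have hcross : traceCLM (S ∘L A.adjoint) = traceCLM (S ∘L A) := by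
    rw [← traceCLM_adjoint, ContinuousLinearMap.adjoint_comp, hself,
      ContinuousLinearMap.adjoint_adjoint, traceCLM_comp_comm]
  have hsq : traceCLM (S.adjoint ∘L S) = 2 * traceCLM (S ∘L A) := by
    rw [hself]
    nth_rewrite 2 [hS]
    rw [ContinuousLinearMap.comp_add, map_add, hcross, two_mul]
  linarith [traceCLM_adjoint_comp_self_nonneg S]

/-- The coefficient `Φ` for which the zero dispersion Euler–Poincaré equations read
`∂ₜu = Φ(Du) u`, from `div (u ⊗ u) = (Du) u + (div u) u` and `½ ∇|u|² = (Du)ᵀ u`. -/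
noncomputable def eulerPoincareCoeff (A : E →L[ℝ] E) : E →L[ℝ] E :=
  -(A + A.adjoint + traceCLM A • ContinuousLinearMap.id ℝ E)

lemma continuous_eulerPoincareCoeff : Continuous (eulerPoincareCoeff (E := E)) := by
  unfold eulerPoincareCoeff
  fun_prop

lemma traceCLM_eulerPoincareCoeff_comp_le (A : E →L[ℝ] E) :
    traceCLM (eulerPoincareCoeff A ∘L A) ≤ -traceCLM A ^ 2 := by
  have hexpand : eulerPoincareCoeff A ∘L A = -((A + A.adjoint) ∘L A) - traceCLM A • A := by
    simp only [eulerPoincareCoeff, ContinuousLinearMap.neg_comp, ContinuousLinearMap.add_comp,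
      ContinuousLinearMap.smul_comp, ContinuousLinearMap.id_comp]
    abel
  rw [hexpand, map_sub, map_neg, map_smul, smul_eq_mul, ← sq]
  linarith [traceCLM_self_add_adjoint_comp_self_nonneg A]

lemma IsQuasilinearSolution.lifespan_le {T : ℝ} {u : ℝ → E → E} {x₀ : E}
    (hu : IsQuasilinearSolution eulerPoincareCoeff T u) (h₀ : u 0 x₀ = 0)
    (hneg : traceCLM (fderiv ℝ (u 0) x₀) < 0) : T ≤ 1 / |traceCLM (fderiv ℝ (u 0) x₀)| := by
  set b := 1 / |traceCLM (fderiv ℝ (u 0) x₀)|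
  by_contra! hT
  have hb : 0 ≤ b := by positivity
  have hcont : ContinuousOn (fun t => traceCLM (fderiv ℝ (u t) x₀)) (Icc 0 b) :=
    traceCLM.continuous.comp_continuousOn <|
      (hu.continuousOn_fderiv.uncurry_right x₀ (mem_univ x₀)).mono (Icc_subset_Ico_right hT)
  have hderiv : ∀ t ∈ Ioo 0 b, HasDerivAt (fun t => traceCLM (fderiv ℝ (u t) x₀))
      (traceCLM (eulerPoincareCoeff (fderiv ℝ (u t) x₀) ∘L fderiv ℝ (u t) x₀)) t := fun t ht =>
    (traceCLM (E := E)).hasFDerivAt.comp_hasDerivAt t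
      (hu.hasDerivAt_fderiv continuous_eulerPoincareCoeff h₀ (Ioo_subset_Ioo_right hT.le ht))
  have hlt : b - 0 < b := lt_one_div_abs_of_deriv_le_neg_sq hb hcont hderiv
    (fun t _ => traceCLM_eulerPoincareCoeff_comp_le _) hneg
  simp at hlt

end EulerPoincare

section Coordinates

variable {N : ℕ}

lemma hasFDerivAt_coord {v : Space N → Space N} {x : Space N} (hv : DifferentiableAt ℝ v x)
    (i : Fin N) :
    HasFDerivAt (fun y => v y i) (EuclideanSpace.proj i ∘L fderiv ℝ v x) x :=
  (EuclideanSpace.proj (𝕜 := ℝ) i).hasFDerivAt.comp x hv.hasFDerivAt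

lemma divergence_eq_traceCLM_fderiv {v : Space N → Space N} {x : Space N}
    (hv : DifferentiableAt ℝ v x) : divergence v x = traceCLM (fderiv ℝ v x) := by
  simp [divergence, partialDeriv, fun i => (hasFDerivAt_coord hv i).fderiv,
    traceCLM_eq_sum_inner (EuclideanSpace.basisFun (Fin N) ℝ), EuclideanSpace.inner_single_left]

lemma sum_partialDeriv_mul {v : Space N → Space N} {x : Space N} (hv : DifferentiableAt ℝ v x)
    (i : Fin N) :
    ∑ j, partialDeriv j (fun y => v y i * v y j) x =
      fderiv ℝ v x (v x) i + divergence v x * v x i := by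
  have hexpand : ∑ j, v x j • EuclideanSpace.single j (1 : ℝ) = v x := by
    simpa using (EuclideanSpace.basisFun (Fin N) ℝ).sum_repr (v x)
  have happly : fderiv ℝ v x (v x) i =
      ∑ j, v x j * fderiv ℝ v x (EuclideanSpace.single j 1) i := by
    conv_lhs => rw [← hexpand]
    simp
  rw [happly, divergence, Finset.sum_mul, ← Finset.sum_add_distrib]
  refine Finset.sum_congr rfl fun j _ => ?_
  rw [partialDeriv, partialDeriv,
    ((hasFDerivAt_coord hv i).fun_mul (hasFDerivAt_coord hv j)).fderiv,
    (hasFDerivAt_coord hv j).fderiv]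
  simp only [add_apply, smul_apply, ContinuousLinearMap.comp_apply, PiLp.proj_apply, smul_eq_mul]
  ring

lemma half_partialDeriv_norm_sq {v : Space N → Space N} {x : Space N}
    (hv : DifferentiableAt ℝ v x) (i : Fin N) :
    (1 / 2) * partialDeriv i (fun y => ‖v y‖ ^ 2) x = (fderiv ℝ v x).adjoint (v x) i := by
  have hadjoint := ContinuousLinearMap.adjoint_inner_left (fderiv ℝ v x)
    (EuclideanSpace.single i (1 : ℝ)) (v x)
  rw [EuclideanSpace.inner_single_right] at hadjoint
  rw [partialDeriv, hv.hasFDerivAt.norm_sq.fderiv]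
  simp [← hadjoint]

lemma IsQuasilinearSolution.of_equation {T : ℝ} {u : ℝ → Space N → Space N}
    (hreg : ContDiffOn ℝ 1 (fun p : ℝ × Space N => u p.1 p.2) (Ico 0 T ×ˢ univ))
    (heq : ∀ t ∈ Ioo 0 T, ∀ (x : Space N) (i : Fin N),
      deriv (fun τ => u τ x i) t
        + ∑ j, partialDeriv j (fun y => u t y i * u t y j) x
        + (1 / 2) * partialDeriv i (fun y => ‖u t y‖ ^ 2) x = 0) :
    IsQuasilinearSolution eulerPoincareCoeff T u where
  contDiffOn := hreg
  hasDerivAt t ht x := by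
    have hjoint : DifferentiableAt ℝ (fun p : ℝ × Space N => u p.1 p.2) (t, x) :=
      (hreg.contDiffAt (prod_mem_nhds (Ico_mem_nhds ht.1 ht.2) univ_mem)).differentiableAt
        one_ne_zero
    have htime : DifferentiableAt ℝ (fun τ => u τ x) t :=
      hjoint.comp t (f := fun τ : ℝ => (τ, x)) (by fun_prop)
    have hspace : DifferentiableAt ℝ (u t) x :=
      hjoint.comp x (f := fun y : Space N => (t, y)) (by fun_prop)
    refine htime.hasDerivAt.congr_deriv ?_
    ext i
    have hcoord : HasDerivAt (fun τ => u τ x i) (deriv (fun τ => u τ x) t i) t :=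
      (EuclideanSpace.proj (𝕜 := ℝ) i).hasFDerivAt.comp_hasDerivAt t htime.hasDerivAt
    have hi := heq t ht x i
    rw [hcoord.deriv, sum_partialDeriv_mul hspace, half_partialDeriv_norm_sq hspace,
      divergence_eq_traceCLM_fderiv hspace] at hi
    simp only [eulerPoincareCoeff, add_apply, neg_apply, smul_apply, ContinuousLinearMap.id_apply,
      PiLp.add_apply, PiLp.neg_apply, PiLp.smul_apply, smul_eq_mul]
    linarith

lemma maximalTime_le {s B : ℝ} {u₀ : Space N → Space N}
    (h : ∀ T u, IsClassicalSolution s u₀ T u → T ≤ B) : maximalTime s u₀ ≤ ENNReal.ofReal B :=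
  iSup₂_le fun T ⟨u, hu⟩ => ENNReal.ofReal_le_ofReal (h T u hu)

end Coordinates

end ZeroDispersion

theorem theorem3_general {N : ℕ} {T : ℝ} (hT : 0 < T)
    {u₀ : ZeroDispersion.Space N → ZeroDispersion.Space N}
    {u : ℝ → ZeroDispersion.Space N → ZeroDispersion.Space N}
    (hreg : ContDiffOn ℝ 1 (fun p : ℝ × ZeroDispersion.Space N => u p.1 p.2) (Ico 0 T ×ˢ univ))
    (hinit : u 0 = u₀)
    (heq : ∀ t ∈ Ioo 0 T, ∀ (x : ZeroDispersion.Space N) (i : Fin N),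
      deriv (fun τ => u τ x i) t
        + ∑ j, ZeroDispersion.partialDeriv j (fun y => u t y i * u t y j) x
        + (1 / 2) * ZeroDispersion.partialDeriv i (fun y => ‖u t y‖ ^ 2) x = 0)
    {x₀ : ZeroDispersion.Space N} (hzero : u₀ x₀ = 0)
    (hdiv : ZeroDispersion.divergence u₀ x₀ < 0) :
    T ≤ 1 / |ZeroDispersion.divergence u₀ x₀| := by
  subst hinit
  have hu := ZeroDispersion.IsQuasilinearSolution.of_equation hreg heq
  have hdiff := (hu.hasFDerivAt (left_mem_Ico.2 hT) x₀).differentiableAt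
  rw [ZeroDispersion.divergence_eq_traceCLM_fderiv hdiff] at hdiv ⊢
  exact hu.lifespan_le hzero hdiv

theorem theorem3 (N : ℕ) (k : ℝ) (hk : (N : ℝ) / 2 + 2 < k)
    (u₀ : ZeroDispersion.Space N → ZeroDispersion.Space N)
    (hu₀ : ZeroDispersion.MemHs k u₀) (hcont : Continuous u₀)
    (hodd : ∀ x, u₀ (-x) = -u₀ x)
    (hdiv : ZeroDispersion.divergence u₀ 0 < 0) :
    ZeroDispersion.maximalTime k u₀ < ⊤ ∧
      ZeroDispersion.maximalTime k u₀ ≤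
        ENNReal.ofReal (1 / |ZeroDispersion.divergence u₀ 0|) := by
  have := IsAddTorsionFree.of_isTorsionFree ℝ (ZeroDispersion.Space N)
  have hle := ZeroDispersion.maximalTime_le (s := k) fun _ _ hu =>
    theorem3_general hu.pos hu.contDiffOn hu.initial hu.equation (Function.Odd.map_zero hodd) hdiv
  exact ⟨hle.trans_lt ENNReal.ofReal_lt_top, hle⟩
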